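/- The game of Containment is played on a finite simple graph $G$ by $k$ cops, who occupy edges of $G$ (several cops may share an edge), and a robber, who occupies a vertex. First the cops choose their edges, then the robber chooses her vertex. After that, each round consists of a move of the cops followed by a move of the robber, with perfect information. In a move of the cops, each cop stays or goes to an edge sharing an endpoint with her current edge. In her move, the robber stays or goes to a neighbouring vertex along an edge not occupied by a cop. The cops win if, after finitely many rounds, all edges incident with the robber's vertex are occupied by cops. The containability number $\xi(G)$ is the minimum number of cops that have a winning strategy on $G$. **Lemma 2.6 (upper bound, part (ii)).** Let $\mathcal G(n,p)$ be the binomial random graph on $n$ vertices with edge probability $p=p(n)\in[0,1]$, and let $d=d(n)=p(n-1)$. Suppose that there is a function $r=r(n)$ with integer values such that, for all sufficiently large $n$, $d\ge \log^3 n$, $r\ge 2$ and $$(n\log n)^{\frac1{2r}}\le d\le (n\log n)^{\frac1{2r-1}}.$$ Then a.a.s. $$\xi(\mathcal G(n,p)) = O\!\left(\frac{n\log n}{d^{\,r-1}}\right),$$ that is, there is a constant $C>0$ such that the probability that $\xi(\mathcal G(n,p))\le C\,\dfrac{n\log n}{d^{\,r-1}}$ tends to $1$ as $n\to\infty$. 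-/

import Mathlib

open Filter Topology

/-! # The game of Containment -/

namespace Containment

variable {V : Type*}

/-- A (deterministic, perfect-information) strategy for `k` cops in the game of Containment on `G`.
`pos h i` is the edge occupied by cop `i` once the cops have moved in response to the trajectory `h`
of the robber, where `h` lists the vertices that she has occupied so far, the most recent one first.
In particular `pos []` is the initial placement of the cops, chosen before the robber appears.
Several cops may occupy the same edge. -/
structure CopStrategy (G : SimpleGraph V) (k : ℕ) where
  /-- The edges occupied by the cops after responding to a trajectory of the robber. -/
  pos : List V → Fin k → Sym2 V
  /-- Cops occupy edges of the graph. -/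
  pos_mem : ∀ h i, pos h i ∈ G.edgeSet
  /-- In a move, each cop goes to an edge that shares an endpoint with her current edge
  (possibly the very same edge: passing is allowed, and any subset of the cops may move). -/
  move : ∀ h v i, ∃ x : V, x ∈ pos h i ∧ x ∈ pos (v :: h) i

/-- `history ρ t = [ρ (t - 1), …, ρ 0]`: what the robber has done before the cops make their
`t`-th move. -/
def history (ρ : ℕ → V) : ℕ → List V
  | 0 => []
  | t + 1 => ρ t :: history ρ t

/-- The sequence `ρ` of robber positions is legal against the strategy `σ`. Here `ρ 0` is her
starting vertex, arbitrary and chosen after the initial placement of the cops. Each round consists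
of a move of the cops and then a move of the robber: in round `t + 1`, she passes or goes from
`ρ t` to a neighbour along an edge on which there is no cop after the cops' move of that round. -/
def IsRobberPlay {G : SimpleGraph V} {k : ℕ} (σ : CopStrategy G k) (ρ : ℕ → V) : Prop :=
  ∀ t, ρ (t + 1) = ρ t ∨
    (G.Adj (ρ t) (ρ (t + 1)) ∧ ∀ i, σ.pos (history ρ (t + 1)) i ≠ s(ρ t, ρ (t + 1)))

/-- After `t` rounds, all edges incident with the robber are occupied by cops. -/
def IsCapturedAt {G : SimpleGraph V} {k : ℕ} (σ : CopStrategy G k) (ρ : ℕ → V) (t : ℕ) : Prop :=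
  ∀ e ∈ G.incidenceSet (ρ t), ∃ i, σ.pos (history ρ t) i = e

/-- The strategy `σ` is winning for the cops: whatever the robber does, she is captured after
finitely many rounds. -/
def CopStrategy.IsWinning {G : SimpleGraph V} {k : ℕ} (σ : CopStrategy G k) : Prop :=
  ∀ ρ : ℕ → V, IsRobberPlay σ ρ → ∃ t, IsCapturedAt σ ρ t

/-- `k` cops have a winning strategy in Containment on `G`. -/
def CopsWin (G : SimpleGraph V) (k : ℕ) : Prop :=
  ∃ σ : CopStrategy G k, σ.IsWinning

/-- The containability number `ξ(G)`: the minimum number of cops that have a winning strategy. -/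
noncomputable def containability (G : SimpleGraph V) : ℕ :=
  sInf {k | CopsWin G k}

/-- One cop on each edge wins, so on a finite graph the minimum in the definition of the
containability number is over a nonempty set. -/
theorem copsWin_ncard_edgeSet [Finite V] (G : SimpleGraph V) : CopsWin G G.edgeSet.ncard := by
  have hf : Finite G.edgeSet := Set.toFinite _
  let f : Fin G.edgeSet.ncard ≃ G.edgeSet := (Finite.equivFin G.edgeSet).symm
  refine ⟨⟨fun _ i => (f i : Sym2 V), fun _ i => (f i).2, fun _ _ i => ?_⟩, fun ρ _ => ⟨0, ?_⟩⟩
  · exact ⟨_, Sym2.out_fst_mem _, Sym2.out_fst_mem _⟩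
  · intro e he
    exact ⟨f.symm ⟨e, he.1⟩, by simp⟩

end Containment

/-!
The cops catch the robber in a ball. Put `q = r - 1` and let each of `K = O(n log n / d ^ q)` cops
start on an edge at a uniformly random vertex. When the robber has chosen her vertex `v`, all edges
that meet the ball of radius `q` around `v` are assigned to distinct cops who can reach them in
`q + 1 = r` moves. The robber needs more than `q` moves to leave the ball, so after the `r`-th move
of the cops every edge at her vertex is occupied (`Containment.copsWin_of_matching`).

The assignment exists by Hall's theorem (`Containment.IsPseudorandom.copsWin`). In the random graph,
sets of size `O(d ^ r)` span `O(log n)` edges per vertex, so a set `A` of edges near `v` covers a set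
`Y` of at least a constant times `|A| / log n` vertices. The ball of radius `q` around `Y` has at
least `|Y| d ^ q / 8` vertices if `|Y| d ^ q ≤ n` (`Containment.IsPseudorandom.le_card_ball`), so the
expected number of cops who start there is a large multiple of `|Y| log n`, and a union bound over
`Y` shows that some placement has enough cops around every such `Y`
(`Containment.exists_placement`). For larger `Y` a subset of size `⌊n / d ^ q⌋` suffices, as the
total number of edges near `v` is at most `2 d ^ r ≤ 2 n log n / d ^ q`; this is where the upper
bound on `d`, in the form `d ^ (2 * r - 1) ≤ n log n`, enters.

The required properties of the random graph are one-step bounds on outer boundaries and numbers of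
spanned edges (`Containment.measure_not_isPseudorandom_le`). The random variables involved count the
members of a disjoint family of sets of pairs that contain an edge, so a single Chernoff bound
(`Containment.measure_hitting_tail`) covers them all. Since `r` may tend to infinity, the boundary
sizes are controlled up to a relative error of order `1 / r`.
-/

namespace Containment

open MeasureTheory ProbabilityTheory

/-! ### Disjoint sets of pairs in the binomial random graph -/

instance measurableSingletonClass_simpleGraph {V : Type*} [Countable V] :
    MeasurableSingletonClass (SimpleGraph V) where
  measurableSet_singleton G := by
    have h : ({G} : Set (SimpleGraph V)) = SimpleGraph.edgeSet ⁻¹' {G.edgeSet} := by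
      ext H; simp
    rw [h]
    exact SimpleGraph.measurableEmbedding_edgeSet.measurable (measurableSet_singleton _)

theorem binomialRandom_real_forall_notMem {V : Type*} [Fintype V] [DecidableEq V]
    (p : unitInterval) (F : Finset (Sym2 V)) (hF : ∀ e ∈ F, ¬ e.IsDiag) :
    (SimpleGraph.binomialRandom V p).real {G | ∀ e ∈ F, e ∉ G.edgeSet} = (1 - (p : ℝ)) ^ F.card := by
  have hm : (SimpleGraph.binomialRandom V p) {G | ∀ e ∈ F, e ∉ G.edgeSet}
      = ∏ e ∈ F, (unitInterval.toNNReal (unitInterval.symm p) : ENNReal) := by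
    rw [SimpleGraph.binomialRandom_eq_map, setBernoulli_eq_map,
      Measure.map_apply (by fun_prop) (Set.toFinite _).measurableSet,
      Measure.map_apply (by fun_prop) (Set.toFinite _).measurableSet]
    have : ((fun p : Sym2 V → Prop ↦ {i | p i}) ⁻¹'
        (SimpleGraph.fromEdgeSet ⁻¹' {G : SimpleGraph V | ∀ e ∈ F, e ∉ G.edgeSet}))
        = Set.pi F (fun _ => {False}) := by
      ext P
      simp only [Set.mem_preimage, SimpleGraph.edgeSet_fromEdgeSet, Set.mem_ofPred_eq, Set.mem_pi,
        Finset.mem_coe, Set.mem_singleton_iff, Set.mem_sdiff]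
      refine forall₂_congr fun e he => ?_
      have := hF e he
      simp [this]
    rw [this, Measure.infinitePi_pi _ (fun _ _ => by measurability)]
    refine Finset.prod_congr rfl fun e he => ?_
    have := hF e he
    simp [this]
  rw [measureReal_def, hm]
  simp

open Classical in
/-- The generating function of the number of members of a disjoint family of sets of pairs that
contain an edge of the random graph. Expanding the product over `i` into a sum over subfamilies
leaves only the probabilities that a given set of pairs contains no edge. -/
theorem integral_prod_binomialRandom {V ι : Type*} [Fintype V]
    (p : unitInterval) (I : Finset ι) (F : ι → Finset (Sym2 V))
    (hF : ∀ i ∈ I, ∀ e ∈ F i, ¬ e.IsDiag)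
    (hdisj : (I : Set ι).PairwiseDisjoint F) (c : ℝ) :
    ∫ G, (∏ i ∈ I, if ∀ e ∈ F i, e ∉ G.edgeSet then 1 else c)
        ∂(SimpleGraph.binomialRandom V p) =
      ∏ i ∈ I, ((1 - c) * (1 - (p : ℝ)) ^ (F i).card + c) := by
  have h1 : ∀ G : SimpleGraph V,
      (∏ i ∈ I, if ∀ e ∈ F i, e ∉ G.edgeSet then 1 else c) =
      ∑ J ∈ I.powerset, ((1 - c) ^ J.card * c ^ (I \ J).card) *
        Set.indicator {G : SimpleGraph V | ∀ e ∈ J.biUnion F, e ∉ G.edgeSet} (fun _ => (1 : ℝ)) G := by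
    intro G
    have h2 : (∏ i ∈ I, if ∀ e ∈ F i, e ∉ G.edgeSet then 1 else c) =
      ∏ i ∈ I, ((1 - c) * (if ∀ e ∈ F i, e ∉ G.edgeSet then 1 else 0) + c) := by
      refine Finset.prod_congr rfl fun i _ => ?_
      split_ifs <;> ring
    rw [h2, Finset.prod_add]
    refine Finset.sum_congr rfl fun J hJ => ?_
    rw [Finset.prod_mul_distrib, Finset.prod_const, Finset.prod_const]
    have h3 : (∏ i ∈ J, if ∀ e ∈ F i, e ∉ G.edgeSet then (1 : ℝ) else 0) =
        Set.indicator {G : SimpleGraph V | ∀ e ∈ J.biUnion F, e ∉ G.edgeSet}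
          (fun _ => (1 : ℝ)) G := by
      rw [Finset.prod_ite_zero, Set.indicator_apply]
      refine if_congr ?_ (by simp) rfl
      simp only [Set.mem_ofPred_eq, Finset.mem_biUnion]
      grind
    rw [h3]; ring
  simp_rw [h1]
  rw [integral_finsetSum _ (fun _ _ => Integrable.of_finite), Finset.prod_add]
  refine Finset.sum_congr rfl fun J hJ => ?_
  have hJI := Finset.mem_powerset.1 hJ
  rw [integral_const_mul, integral_indicator_const _ (Set.toFinite _).measurableSet,
    binomialRandom_real_forall_notMem, Finset.card_biUnion, Finset.prod_mul_distrib,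
    Finset.prod_const, Finset.prod_const, Finset.prod_pow_eq_pow_sum]
  · simp; ring
  · intro i hi j hj hij
    exact hdisj (hJI hi) (hJI hj) hij
  · intro e he
    obtain ⟨i, hi, he⟩ := Finset.mem_biUnion.1 he
    exact hF i (hJI hi) e he

open Classical in
/-- Chernoff's bound for the number of members of a disjoint family of sets of pairs that contain an
edge of the random graph: the upper tail for `0 < l`, the lower tail for `l < 0`. -/
theorem measure_hitting_tail {V ι : Type*} [Fintype V]
    (p : unitInterval) (I : Finset ι) (F : ι → Finset (Sym2 V))
    (hF : ∀ i ∈ I, ∀ e ∈ F i, ¬ e.IsDiag)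
    (hdisj : (I : Set ι).PairwiseDisjoint F) (l t : ℝ) :
    (SimpleGraph.binomialRandom V p).real
        {G | l * t ≤ l * ((I.filter fun i => ∃ e ∈ F i, e ∈ G.edgeSet).card : ℝ)} ≤
      Real.exp (-(l * t) +
        (Real.exp l - 1) * ∑ i ∈ I, (1 - (1 - (p : ℝ)) ^ (F i).card)) := by
  have hX : ∀ G : SimpleGraph V,
      Real.exp (l * ((I.filter fun i => ∃ e ∈ F i, e ∈ G.edgeSet).card : ℝ)) =
        ∏ i ∈ I, if ∀ e ∈ F i, e ∉ G.edgeSet then 1 else Real.exp l := by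
    intro G
    rw [mul_comm, Real.exp_nat_mul, Finset.prod_ite, Finset.prod_const_one, one_mul,
      Finset.prod_const]
    congr 3
    ext i
    simp
  have hM := mul_meas_ge_le_integral_of_nonneg (μ := SimpleGraph.binomialRandom V p)
    (f := fun G => Real.exp (l * ((I.filter fun i => ∃ e ∈ F i, e ∈ G.edgeSet).card : ℝ)))
    (ae_of_all _ fun _ => (Real.exp_pos _).le) (Integrable.of_finite) (Real.exp (l * t))
  simp only [Real.exp_le_exp] at hM
  simp_rw [hX] at hM
  rw [integral_prod_binomialRandom p I F hF hdisj] at hM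
  rw [Real.exp_add, Real.exp_neg, inv_mul_eq_div, le_div_iff₀ (Real.exp_pos _), mul_comm]
  refine hM.trans ?_
  rw [Finset.mul_sum, Real.exp_sum]
  refine Finset.prod_le_prod (fun i _ => ?_) (fun i _ => ?_)
  · have h1 : (0 : ℝ) ≤ (1 - (p : ℝ)) ^ (F i).card := pow_nonneg (by linarith [p.2.2]) _
    have h2 : (1 - (p : ℝ)) ^ (F i).card ≤ 1 :=
      pow_le_one₀ (by linarith [p.2.2]) (by linarith [p.2.1])
    nlinarith [Real.exp_pos l]
  · have := Real.add_one_le_exp ((Real.exp l - 1) * (1 - (1 - (p : ℝ)) ^ (F i).card))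
    linarith

/-- The sum that arises in a union bound over all nonempty sets `S` of vertices, when the event
attached to `S` has probability at most `x ^ S.card`. -/
theorem sum_pow_card_nonempty_le {V : Type*} [Fintype V] [DecidableEq V] (x : ℝ) (hx : 0 ≤ x) :
    ∑ S ∈ (Finset.univ : Finset (Finset V)).filter (·.Nonempty), x ^ S.card ≤
      Real.exp (Fintype.card V * x) - 1 := by
  have h := Fintype.sum_pow_mul_eq_add_pow V x 1
  simp only [one_pow, mul_one] at h
  have h2 : (Finset.univ : Finset (Finset V)).filter (·.Nonempty) = Finset.univ.erase ∅ := by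
    ext S; simp [Finset.nonempty_iff_ne_empty]
  have h3 := Finset.add_sum_erase Finset.univ (fun S : Finset V => x ^ S.card) (Finset.mem_univ ∅)
  have h4 : (x + 1) ^ Fintype.card V ≤ Real.exp (Fintype.card V * x) := by
    rw [Real.exp_nat_mul]
    exact pow_le_pow_left₀ (by linarith) (Real.add_one_le_exp x) _
  rw [h2]
  simp only [Finset.card_empty, pow_zero] at h3
  linarith

/-! ### Balls and pursuit -/

open Classical in
/-- The vertices outside `S` that have a neighbour in `S`. -/
noncomputable def outerBoundary {V : Type*} [Fintype V] (G : SimpleGraph V) (S : Finset V) :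
    Finset V :=
  Finset.univ.filter fun x => x ∉ S ∧ ∃ y ∈ S, G.Adj y x

open Classical in
/-- The closed ball of radius `j` around a set of vertices: the vertices joined to some member of
`S` by a walk of length at most `j`. -/
noncomputable def ball {V : Type*} [Fintype V] (G : SimpleGraph V) : ℕ → Finset V → Finset V
  | 0, S => S
  | j + 1, S => ball G j S ∪ outerBoundary G (ball G j S)

theorem length_history {V : Type*} (ρ : ℕ → V) (t : ℕ) : (history ρ t).length = t := by
  induction t with
  | zero => rfl
  | succ t ih => simp [history, ih]

theorem getLast_history {V : Type*} (ρ : ℕ → V) (t : ℕ) (a : V) :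
    (history ρ (t + 1)).getLastD a = ρ 0 := by
  induction t with
  | zero => simp [history]
  | succ t ih =>
    rw [history]
    simp only [history, List.getLastD_cons] at ih ⊢
    exact ih

section ball

variable {V : Type*} [Fintype V] {G : SimpleGraph V}

theorem mem_outerBoundary {S : Finset V} {x : V} :
    x ∈ outerBoundary G S ↔ x ∉ S ∧ ∃ y ∈ S, G.Adj y x := by
  simp [outerBoundary]

theorem mem_ball_succ {j : ℕ} {S : Finset V} {x : V} :
    x ∈ ball G (j + 1) S ↔ x ∈ ball G j S ∨ ∃ y ∈ ball G j S, G.Adj y x := by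
  classical
  simp only [ball, Finset.mem_union, mem_outerBoundary]
  tauto

theorem exists_mem_ball_singleton {j : ℕ} {S : Finset V} {x : V} (hx : x ∈ ball G j S) :
    ∃ y ∈ S, x ∈ ball G j {y} := by
  induction j generalizing x with
  | zero => exact ⟨x, hx, by simp [ball]⟩
  | succ j ih =>
    rw [mem_ball_succ] at hx
    rcases hx with hx | ⟨z, hz, hzx⟩
    · obtain ⟨y, hy, h⟩ := ih hx
      exact ⟨y, hy, mem_ball_succ.2 (Or.inl h)⟩
    · obtain ⟨y, hy, h⟩ := ih hz
      exact ⟨y, hy, mem_ball_succ.2 (Or.inr ⟨z, h, hzx⟩)⟩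

/-- A cop on an edge at `w` can reach any edge at `y` in `j + 1` moves if `w` and `y` are at distance
at most `j`. The route `γ` stays at its target from then on. -/
theorem exists_route {j : ℕ} {y w : V} (hw : w ∈ ball G j {y}) {e f : Sym2 V}
    (he : e ∈ G.edgeSet) (hwe : w ∈ e) (hf : f ∈ G.edgeSet) (hyf : y ∈ f) :
    ∃ γ : ℕ → Sym2 V, γ 0 = e ∧ (∀ t, j < t → γ t = f) ∧ (∀ t, γ t ∈ G.edgeSet) ∧
      ∀ t, ∃ x : V, x ∈ γ t ∧ x ∈ γ (t + 1) := by
  induction j generalizing w e with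
  | zero =>
    obtain rfl : w = y := by simpa [ball] using hw
    refine ⟨fun t => Nat.casesOn t e fun _ => f, rfl, ?_, ?_, ?_⟩
    · rintro (_ | t) ht
      · omega
      · rfl
    · rintro (_ | t)
      · exact he
      · exact hf
    · rintro (_ | t)
      · exact ⟨w, hwe, hyf⟩
      · exact ⟨w, hyf, hyf⟩
  | succ j ih =>
    rw [mem_ball_succ] at hw
    rcases hw with hw | ⟨z, hz, hzw⟩
    · obtain ⟨γ, h0, h1, h2⟩ := ih hw he hwe
      exact ⟨γ, h0, fun t ht => h1 t (by omega), h2⟩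
    · obtain ⟨γ, h0, h1, h2, h3⟩ :=
        ih (e := s(z, w)) hz hzw (Sym2.mem_mk_left _ _)
      refine ⟨fun t => Nat.casesOn t e γ, rfl, ?_, ?_, ?_⟩
      · rintro (_ | t) ht
        · omega
        · exact h1 t (by omega)
      · rintro (_ | t)
        · exact he
        · exact h2 t
      · rintro (_ | t)
        · exact ⟨w, hwe, by simp [h0]⟩
        · exact h3 t

/-- The edges with at least one endpoint in `S`. -/
def edgesMeeting (G : SimpleGraph V) (S : Finset V) : Set (Sym2 V) :=
  {e | e ∈ G.edgeSet ∧ ∃ x ∈ e, x ∈ S}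

theorem IsRobberPlay.mem_ball {k : ℕ} {σ : CopStrategy G k} {ρ : ℕ → V} (h : IsRobberPlay σ ρ)
    (t : ℕ) : ρ t ∈ ball G t {ρ 0} := by
  induction t with
  | zero => simp [ball]
  | succ t ih =>
    rw [mem_ball_succ]
    rcases h t with h | h
    · exact Or.inl (h ▸ ih)
    · exact Or.inr ⟨_, ih, h.1⟩

/-- Let cop `i` start on an edge at `w i`. If for every starting vertex `v` of the robber the edges
that meet the ball of radius `q` around `v` can be assigned to distinct cops, each within reach in
`q + 1` moves, then the cops win: after `q` rounds the robber is still in the ball, and the next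
move of the cops occupies every edge that meets it. -/
theorem copsWin_of_matching {k q : ℕ} [Nonempty V] (w : Fin k → V) (hdeg : ∀ v, ∃ u, G.Adj v u)
    (hmatch : ∀ v : V, ∃ f : edgesMeeting G (ball G q {v}) → Fin k, Function.Injective f ∧
      ∀ e, ∃ y ∈ e.1, w (f e) ∈ ball G q {y}) : CopsWin G k := by
  classical
  obtain ⟨v₀⟩ := ‹Nonempty V›
  choose u hu using hdeg
  -- the initial edge of cop `i`
  let e₀ : Fin k → Sym2 V := fun i => s(w i, u (w i))
  have hroute : ∀ v i, ∃ γ : ℕ → Sym2 V, γ 0 = e₀ i ∧ (∀ t, γ t ∈ G.edgeSet) ∧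
      (∀ t, ∃ x : V, x ∈ γ t ∧ x ∈ γ (t + 1)) ∧
      ∀ e, (hmatch v).choose e = i → γ (q + 1) = e := by
    intro v i
    have hspec := (hmatch v).choose_spec
    by_cases hi : ∃ e, (hmatch v).choose e = i
    · obtain ⟨e, he⟩ := hi
      obtain ⟨y, hy, hw⟩ := hspec.2 e
      rw [he] at hw
      obtain ⟨γ, h0, h1, h2, h3⟩ := exists_route hw (e := e₀ i) (hu _) (Sym2.mem_mk_left _ _)
        e.2.1 hy
      refine ⟨γ, h0, h2, h3, fun e' he' => ?_⟩
      rw [hspec.1 (he'.trans he.symm)]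
      exact h1 _ (by omega)
    · exact ⟨fun _ => e₀ i, rfl, fun _ => hu _,
        fun _ => ⟨w i, Sym2.mem_mk_left _ _, Sym2.mem_mk_left _ _⟩, fun e he => (hi ⟨e, he⟩).elim⟩
  choose γ h0 hE hmove htarget using hroute
  -- the starting vertex of the robber, which fixes the routes, is the last entry of her trajectory;
  -- the default `v₀` is harmless, since all routes of cop `i` start at `e₀ i`
  let σ : CopStrategy G k :=
    { pos := fun h i => γ (h.getLastD v₀) i h.length
      pos_mem := fun h i => hE _ _ _
      move := by
        intro h v i
        rcases h with _ | ⟨a, h⟩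
        · obtain ⟨x, hx, hx'⟩ := hmove v i 0
          refine ⟨x, ?_, by simpa using hx'⟩
          rw [h0] at hx
          simpa [h0] using hx
        · simpa using hmove _ i _ }
  refine ⟨σ, fun ρ hρ => ⟨q + 1, ?_⟩⟩
  -- after the cops' `(q + 1)`-st move all edges that meet the ball are occupied
  have hocc : ∀ e ∈ edgesMeeting G (ball G q {ρ 0}), ∃ i, σ.pos (history ρ (q + 1)) i = e := by
    intro e he
    refine ⟨(hmatch (ρ 0)).choose ⟨e, he⟩, ?_⟩
    change γ _ _ _ = e
    rw [getLast_history, length_history]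
    exact htarget _ _ _ rfl
  have hq := hρ.mem_ball q
  have hstay : ρ (q + 1) = ρ q := by
    rcases hρ q with h | ⟨h, h'⟩
    · exact h
    · obtain ⟨i, hi⟩ := hocc s(ρ q, ρ (q + 1)) ⟨h, _, Sym2.mem_mk_left _ _, hq⟩
      exact (h' i hi).elim
  intro e he
  rw [hstay] at he
  exact hocc e ⟨he.1, _, he.2, hq⟩

end ball

/-! ### Expansion and Hall's condition in pseudorandom graphs -/

open Classical in
/-- The properties of a random graph of average degree `d` that the cops rely on: sets of at most
`M` vertices span few edges, and the outer boundary of a set `S` has roughly `d * S.card` vertices,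
with relative error `2 * ε` as long as `d * S.card` is much smaller than the number of vertices.
`L` stands for the logarithm of the number of vertices. -/
structure IsPseudorandom {V : Type*} [Fintype V] (G : SimpleGraph V) (d ε L M : ℝ) : Prop where
  sparse : ∀ S : Finset V, S.Nonempty → (S.card : ℝ) ≤ M →
    ((S.sym2.filter (· ∈ G.edgeSet)).card : ℝ) ≤ 7 * L * S.card
  upper : ∀ S : Finset V, S.Nonempty → ((outerBoundary G S).card : ℝ) ≤ (1 + ε) * d * S.card
  lower : ∀ S : Finset V, S.Nonempty → d * S.card ≤ Fintype.card V →
    d * S.card * (1 - 2 * ε - 2 / 3 * (d * S.card / Fintype.card V)) ≤ (outerBoundary G S).card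

section pseudorandom

variable {V : Type*} [Fintype V] {G : SimpleGraph V} {d ε L M : ℝ}

theorem subset_ball (G : SimpleGraph V) (j : ℕ) (S : Finset V) : S ⊆ ball G j S := by
  induction j with
  | zero => exact subset_rfl
  | succ j ih => exact fun x hx => mem_ball_succ.2 (Or.inl (ih hx))

theorem IsPseudorandom.card_ball_le (h : IsPseudorandom G d ε L M) (hεd : 1 ≤ ε * d) (hε : 0 < ε)
    (j : ℕ) {S : Finset V} (hS : S.Nonempty) :
    ((ball G j S).card : ℝ) ≤ ((1 + 2 * ε) * d) ^ j * S.card := by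
  classical
  have hd : 0 < d := by by_contra hd; nlinarith
  induction j with
  | zero => simp [ball]
  | succ j ih =>
    have h1 := h.upper _ (hS.mono (subset_ball G j S))
    have h2 : ((ball G (j + 1) S).card : ℝ) ≤
        (ball G j S).card + (outerBoundary G (ball G j S)).card := by
      exact_mod_cast Finset.card_union_le _ _
    have h3 : (0 : ℝ) ≤ (ball G j S).card := Nat.cast_nonneg _
    calc ((ball G (j + 1) S).card : ℝ) ≤ ((1 + 2 * ε) * d) * (ball G j S).card := by nlinarith
      _ ≤ ((1 + 2 * ε) * d) * (((1 + 2 * ε) * d) ^ j * S.card) := by gcongr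
      _ = _ := by ring

theorem IsPseudorandom.ncard_edgesMeeting_le (h : IsPseudorandom G d ε L M) (S : Finset V) :
    ((edgesMeeting G S).ncard : ℝ) ≤ (1 + ε) * d * S.card := by
  classical
  have hsub : edgesMeeting G S ⊆
      (S.biUnion fun x => (outerBoundary G {x}).image fun y => s(x, y) : Finset (Sym2 V)) := by
    rintro e ⟨he, x, hxe, hx⟩
    obtain ⟨y, rfl⟩ := hxe
    simp only [Finset.coe_biUnion, Set.mem_iUnion, Finset.mem_coe, Finset.mem_image]
    refine ⟨x, hx, y, ?_, rfl⟩
    rw [mem_outerBoundary]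
    exact ⟨by simpa using (G.ne_of_adj he).symm, x, by simp, he⟩
  have h1 : (edgesMeeting G S).ncard ≤
      (S.biUnion fun x => (outerBoundary G {x}).image fun y => s(x, y)).card := by
    rw [← Set.ncard_coe_finset]
    exact Set.ncard_le_ncard hsub (Finset.finite_toSet _)
  have h2 := h1.trans Finset.card_biUnion_le
  calc ((edgesMeeting G S).ncard : ℝ)
      ≤ ∑ x ∈ S, (((outerBoundary G {x}).image fun y => s(x, y)).card : ℝ) := by exact_mod_cast h2
    _ ≤ ∑ x ∈ S, (1 + ε) * d := by
      refine Finset.sum_le_sum fun x _ => ?_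
      have h3 := h.upper {x} (Finset.singleton_nonempty x)
      rw [Finset.card_singleton, Nat.cast_one, mul_one] at h3
      exact le_trans (by exact_mod_cast Finset.card_image_le) h3
    _ = _ := by rw [Finset.sum_const, nsmul_eq_mul]; ring

/-- Balls grow by a factor close to `d` as long as their size stays below the number of vertices
divided by `d`. The subset `T` is there to cap the size, since the lower bound on boundaries is only
effective for sets that are not too large. -/
theorem IsPseudorandom.exists_subset_ball (h : IsPseudorandom G d ε L M) (hεd : 1 ≤ ε * d)
    (hε : 0 < ε) (hε1 : ε ≤ 1 / 16) {q : ℕ} {Y : Finset V} (hY : Y.Nonempty)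
    (hn : Y.card * d ^ q ≤ Fintype.card V) (j : ℕ) (hj : j + 1 ≤ q) :
    ∃ T ⊆ ball G j Y, (1 - 4 * ε) ^ j * (Y.card * d ^ j) ≤ T.card ∧ T.card ≤ Y.card * d ^ j := by
  have hd : 16 ≤ d := by by_contra hd; nlinarith
  have hY1 : (1 : ℝ) ≤ Y.card := by exact_mod_cast hY.card_pos
  have hn0 : (0 : ℝ) < Fintype.card V := lt_of_lt_of_le (by positivity) hn
  induction j with
  | zero => exact ⟨Y, by simp [ball], by simp⟩
  | succ j ih =>
    obtain ⟨T, hT, hT1, hT2⟩ := ih (by omega)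
    have hε4 : 0 < 1 - 4 * ε := by linarith
    have hTpos : (0 : ℝ) < T.card := lt_of_lt_of_le (by positivity) hT1
    have hTne : T.Nonempty := Finset.card_pos.1 (by exact_mod_cast hTpos)
    have hbig : d * (d * T.card) ≤ Fintype.card V := by
      calc d * (d * T.card) ≤ d * (d * (Y.card * d ^ j)) := by gcongr
        _ = Y.card * d ^ (j + 2) := by ring
        _ ≤ Y.card * d ^ q := by gcongr; linarith
        _ ≤ _ := hn
    have hfrac : d * T.card / Fintype.card V ≤ ε := by
      rw [div_le_iff₀ hn0]
      nlinarith [mul_le_mul_of_nonneg_right hεd (by positivity : (0 : ℝ) ≤ d * T.card)]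
    have hdT : 0 < d * T.card := by positivity
    have hlow := h.lower T hTne (by nlinarith)
    have hlow' : (1 - 4 * ε) ^ (j + 1) * (Y.card * d ^ (j + 1)) ≤ (outerBoundary G T).card := by
      calc (1 - 4 * ε) ^ (j + 1) * (Y.card * d ^ (j + 1))
          = (1 - 4 * ε) * d * ((1 - 4 * ε) ^ j * (Y.card * d ^ j)) := by ring
        _ ≤ (1 - 4 * ε) * d * T.card := by gcongr
        _ ≤ _ := le_trans (by nlinarith) hlow
    have hsub : outerBoundary G T ⊆ ball G (j + 1) Y := by
      intro x hx
      obtain ⟨-, y, hy, hyx⟩ := mem_outerBoundary.1 hx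
      exact mem_ball_succ.2 (Or.inr ⟨y, hT hy, hyx⟩)
    by_cases hle : ((outerBoundary G T).card : ℝ) ≤ Y.card * d ^ (j + 1)
    · exact ⟨_, hsub, hlow', hle⟩
    · have hz : (0 : ℝ) ≤ Y.card * d ^ (j + 1) := by positivity
      have hfl : ⌊(Y.card * d ^ (j + 1) : ℝ)⌋₊ ≤ (outerBoundary G T).card := by
        have := Nat.floor_le hz
        exact_mod_cast this.trans (not_le.1 hle).le
      obtain ⟨T', hT', hcard⟩ := Finset.exists_subset_card_eq hfl
      refine ⟨T', hT'.trans hsub, ?_, by rw [hcard]; exact Nat.floor_le hz⟩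
      rw [hcard]
      have h1 := Nat.lt_floor_add_one (Y.card * d ^ (j + 1) : ℝ)
      have h2 : (1 - 4 * ε) ^ (j + 1) ≤ 1 - 4 * ε := by
        rw [pow_succ]
        have := pow_le_one₀ (n := j) hε4.le (by linarith)
        nlinarith
      have h3 : d ≤ Y.card * d ^ (j + 1) := by
        have := one_le_pow₀ (n := j) (by linarith : 1 ≤ d)
        calc d = 1 * (1 * d) := by ring
          _ ≤ Y.card * (d ^ j * d) := by gcongr
          _ = _ := by ring
      nlinarith

/-- All growth steps but the last lose a factor `1 - 4 * ε`, which in total is at least `3 / 4`; in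
the last step the boundary may be comparable to the whole vertex set, and a constant factor is
lost. -/
theorem IsPseudorandom.le_card_ball (h : IsPseudorandom G d ε L M) (hεd : 1 ≤ ε * d)
    (hε : 0 < ε) {q : ℕ} (hq : 1 ≤ q) (hεq : ε * (16 * q) ≤ 1) {Y : Finset V} (hY : Y.Nonempty)
    (hn : Y.card * d ^ q ≤ Fintype.card V) : Y.card * (d ^ q / 8) ≤ (ball G q Y).card := by
  obtain ⟨q, rfl⟩ : ∃ k, q = k + 1 := ⟨q - 1, by omega⟩
  push_cast at hεq
  have hε1 : ε ≤ 1 / 16 := by nlinarith [(Nat.cast_nonneg q : (0 : ℝ) ≤ q)]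
  have hd : 16 ≤ d := by by_contra hd; nlinarith
  have hY1 : (1 : ℝ) ≤ Y.card := by exact_mod_cast hY.card_pos
  have hn0 : (0 : ℝ) < Fintype.card V := lt_of_lt_of_le (by positivity) hn
  obtain ⟨T, hT, hT1, hT2⟩ := h.exists_subset_ball hεd hε hε1 hY hn q le_rfl
  have hε4 : 0 < 1 - 4 * ε := by linarith
  have hpow : 3 / 4 ≤ (1 - 4 * ε) ^ q := by
    have := one_add_mul_le_pow (a := -(4 * ε)) (by linarith) q
    rw [← sub_eq_add_neg] at this
    nlinarith
  have hTlow : 3 / 4 * (Y.card * d ^ q) ≤ T.card := le_trans (by gcongr) hT1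
  have hTpos : (0 : ℝ) < T.card := lt_of_lt_of_le (by positivity) hTlow
  have hTne : T.Nonempty := Finset.card_pos.1 (by exact_mod_cast hTpos)
  have hbig : d * T.card ≤ Fintype.card V := by
    calc d * T.card ≤ d * (Y.card * d ^ q) := by gcongr
      _ = Y.card * d ^ (q + 1) := by ring
      _ ≤ _ := hn
  have hfrac : d * T.card / Fintype.card V ≤ 1 := (div_le_one hn0).2 hbig
  have hsub : outerBoundary G T ⊆ ball G (q + 1) Y := by
    intro x hx
    obtain ⟨-, y, hy, hyx⟩ := mem_outerBoundary.1 hx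
    exact mem_ball_succ.2 (Or.inr ⟨y, hT hy, hyx⟩)
  have hdT : 0 < d * T.card := by positivity
  calc (Y.card * (d ^ (q + 1) / 8) : ℝ)
      ≤ d * (3 / 4 * (Y.card * d ^ q)) * (1 / 6) := le_of_eq (by ring)
    _ ≤ d * T.card * (1 / 6) := by gcongr
    _ ≤ d * T.card * (1 - 2 * ε - 2 / 3 * (d * T.card / Fintype.card V)) := by
      gcongr; linarith
    _ ≤ (outerBoundary G T).card := h.lower T hTne hbig
    _ ≤ (ball G (q + 1) Y).card := by exact_mod_cast Finset.card_le_card hsub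

open Classical in
/-- If every small nonempty set `Y` comes with a set `B Y` of at least `Y.card * b` vertices, then
some placement of `K` points has at least `7 * L * Y.card` points in each `B Y`. A uniformly random
placement has this property with positive probability; the proof counts placements. -/
theorem exists_placement [Nonempty V] (B : Finset V → Finset V) {K : ℕ} {m b : ℝ}
    (hB : ∀ Y : Finset V, Y.Nonempty → Y.card ≤ m → Y.card * b ≤ (B Y).card)
    (hK : 20 * L * Fintype.card V ≤ K * b) (hn : Fintype.card V * Real.exp (-3 * L) ≤ 1 / 2) :
    ∃ w : Fin K → V, ∀ Y : Finset V, Y.Nonempty → Y.card ≤ m →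
      7 * L * Y.card ≤ ((Finset.univ.filter fun i => w i ∈ B Y).card : ℝ) := by
  -- If each placement `w` fails at some `Y`, then `1 ≤ ∑ Y, exp (7 L |Y| - X w Y)`, where `X w Y`
  -- is the number of points in `B Y`. Summing over `w` gives a contradiction, as the average over
  -- `w` of the term for `Y` is at most `exp (-3 L |Y|)`.
  by_contra! hcon
  set n : ℝ := (Fintype.card V : ℝ) with hn_def
  have hnpos : 0 < n := by rw [hn_def]; exact_mod_cast Fintype.card_pos
  let P := (Finset.univ : Finset (Finset V)).filter fun Y => Y.Nonempty ∧ (Y.card : ℝ) ≤ m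
  have hexp : ∀ (w : Fin K → V) (Y : Finset V),
      Real.exp (-((Finset.univ.filter fun i => w i ∈ B Y).card : ℝ)) =
        ∏ i, if w i ∈ B Y then Real.exp (-1) else 1 := by
    intro w Y
    rw [Finset.prod_ite, Finset.prod_const_one, mul_one, Finset.prod_const, ← Real.exp_nat_mul]
    simp
  have hsum : ∀ Y ∈ P, ∑ w : Fin K → V, Real.exp (7 * L * Y.card -
      ((Finset.univ.filter fun i => w i ∈ B Y).card : ℝ)) ≤ n ^ K * Real.exp (-3 * L) ^ Y.card := by
    intro Y hY
    obtain ⟨-, hYne, hYm⟩ := Finset.mem_filter.1 hY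
    have hbase : ∑ v : V, (if v ∈ B Y then Real.exp (-1) else 1) ≤
        n * Real.exp (-((B Y).card / (2 * n))) := by
      have h1 : ∑ v : V, (if v ∈ B Y then Real.exp (-1) else 1) =
          n - (B Y).card * (1 - Real.exp (-1)) := by
        have : ∀ v : V, (if v ∈ B Y then Real.exp (-1) else (1 : ℝ)) =
            1 - if v ∈ B Y then 1 - Real.exp (-1) else 0 := by
          intro v; split_ifs <;> ring
        simp_rw [this]
        rw [Finset.sum_sub_distrib, Finset.sum_ite_mem]
        simp [hn_def]
        ring
      have h2 : Real.exp (-1) ≤ 1 / 2 := by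
        have := Real.exp_neg_one_lt_half
        linarith
      have h3 := Real.add_one_le_exp (-((B Y).card / (2 * n)))
      have h4 : n * ((B Y).card / (2 * n)) = (B Y).card / 2 := by field_simp
      have h5 : (0 : ℝ) ≤ (B Y).card := Nat.cast_nonneg _
      rw [h1]
      nlinarith
    have hmean : 10 * L * Y.card ≤ K * ((B Y).card / (2 * n)) := by
      rw [← mul_div_assoc, le_div_iff₀ (by positivity)]
      have h1 := hB Y hYne hYm
      have h2 : (0 : ℝ) ≤ Y.card := Nat.cast_nonneg _
      have h3 : (0 : ℝ) ≤ K := Nat.cast_nonneg _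
      nlinarith [mul_le_mul_of_nonneg_left h1 h3, mul_le_mul_of_nonneg_left hK h2]
    calc ∑ w : Fin K → V, Real.exp (7 * L * Y.card -
            ((Finset.univ.filter fun i => w i ∈ B Y).card : ℝ))
        = Real.exp (7 * L * Y.card) *
            (∑ v : V, (if v ∈ B Y then Real.exp (-1) else 1)) ^ K := by
          rw [Fintype.sum_pow, Finset.mul_sum]
          refine Finset.sum_congr rfl fun w _ => ?_
          rw [sub_eq_add_neg, Real.exp_add, hexp]
      _ ≤ Real.exp (7 * L * Y.card) * (n * Real.exp (-((B Y).card / (2 * n)))) ^ K := by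
          gcongr
      _ = n ^ K * Real.exp (7 * L * Y.card - K * ((B Y).card / (2 * n))) := by
          rw [mul_pow, ← Real.exp_nat_mul, sub_eq_add_neg, Real.exp_add]; ring_nf
      _ ≤ n ^ K * Real.exp (-3 * L) ^ Y.card := by
          rw [← Real.exp_nat_mul]
          gcongr
          linarith
  have htot : (n ^ K : ℝ) ≤ n ^ K * (Real.exp (1 / 2) - 1) := by
    calc (n ^ K : ℝ) = ∑ w : Fin K → V, (1 : ℝ) := by simp [hn_def]
      _ ≤ ∑ w : Fin K → V, ∑ Y ∈ P, Real.exp (7 * L * Y.card -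
            ((Finset.univ.filter fun i => w i ∈ B Y).card : ℝ)) := by
          refine Finset.sum_le_sum fun w _ => ?_
          obtain ⟨Y, hYne, hYm, hlt⟩ := hcon w
          refine le_trans ?_ (Finset.single_le_sum (fun _ _ => (Real.exp_pos _).le)
            (Finset.mem_filter.2 ⟨Finset.mem_univ Y, hYne, hYm⟩))
          exact Real.one_le_exp (by linarith)
      _ = ∑ Y ∈ P, ∑ w : Fin K → V, Real.exp (7 * L * Y.card -
            ((Finset.univ.filter fun i => w i ∈ B Y).card : ℝ)) := Finset.sum_comm
      _ ≤ ∑ Y ∈ P, n ^ K * Real.exp (-3 * L) ^ Y.card := Finset.sum_le_sum hsum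
      _ = n ^ K * ∑ Y ∈ P, Real.exp (-3 * L) ^ Y.card := by rw [Finset.mul_sum]
      _ ≤ n ^ K * ∑ Y ∈ (Finset.univ : Finset (Finset V)).filter (·.Nonempty),
            Real.exp (-3 * L) ^ Y.card := by
          gcongr
          intro Y hY
          simp only [P, Finset.mem_filter] at hY ⊢
          tauto
      _ ≤ n ^ K * (Real.exp (1 / 2) - 1) := by
          gcongr
          refine (sum_pow_card_nonempty_le _ (Real.exp_pos _).le).trans ?_
          gcongr
  have h1 : Real.exp (1 / 2) < 2 := by
    have h2 : Real.exp (1 / 2) * Real.exp (1 / 2) = Real.exp 1 := by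
      rw [← Real.exp_add]; norm_num
    nlinarith [Real.exp_one_lt_d9, Real.exp_pos (1 / 2 : ℝ)]
  have h2 : 0 < n ^ K := by positivity
  nlinarith

/-- The matching required by `copsWin_of_matching` comes from Hall's theorem. A set `A` of edges
near `v` has a vertex set `Y` with `A.card ≤ 7 * L * Y.card`, and that many cops are within reach
of `Y`, provided that `Y` has at most `n / d ^ q` elements. A larger `Y` contains a subset of
`⌊n / d ^ q⌋` elements, within whose reach there are already enough cops for all edges near
`v`. -/
theorem IsPseudorandom.copsWin [Nonempty V] {q K : ℕ}
    (h : IsPseudorandom G d ε L (2 * d ^ (q + 1))) (hεd : 1 ≤ ε * d) (hε : 0 < ε) (hq : 1 ≤ q)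
    (hεq : ε * (16 * (q + 1)) ≤ 1) (hL : 0 < L) (hdn : d ^ q ≤ Fintype.card V)
    (hdL : d ^ (2 * q + 1) ≤ Fintype.card V * L) (hn : Fintype.card V * Real.exp (-3 * L) ≤ 1 / 2)
    (hK : 160 * (Fintype.card V * L) ≤ K * d ^ q) : CopsWin G K := by
  classical
  set n : ℝ := (Fintype.card V : ℝ) with hn_def
  have hq1 : (1 : ℝ) ≤ q := by exact_mod_cast hq
  have hε1 : ε ≤ 1 / 32 := by nlinarith
  have hd : 32 ≤ d := by by_contra hd; nlinarith
  have hdpow : 0 < d ^ q := by positivity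
  have hdq : d ≤ d ^ q := by
    calc d = d ^ 1 := (pow_one d).symm
      _ ≤ d ^ q := pow_le_pow_right₀ (by linarith) hq
  have hnpos : 0 < n := lt_of_lt_of_le hdpow hdn
  -- `w i` is a vertex of the initial edge of cop `i`
  obtain ⟨w, hw⟩ := exists_placement (V := V) (L := L) (ball G q) (K := K) (m := n / d ^ q)
    (b := d ^ q / 8)
    (fun Y hY hm => h.le_card_ball hεd hε hq (by linarith) hY ((le_div_iff₀ hdpow).1 hm))
    (by linarith) hn
  have hone : (1 + 2 * ε) ^ (q + 1) ≤ 2 := by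
    calc (1 + 2 * ε) ^ (q + 1) ≤ Real.exp (2 * ε) ^ (q + 1) := by
          gcongr
          linarith [Real.add_one_le_exp (2 * ε)]
      _ = Real.exp ((q + 1 : ℕ) * (2 * ε)) := (Real.exp_nat_mul _ _).symm
      _ ≤ Real.exp (1 / 2) := by
          gcongr
          push_cast
          linarith
      _ ≤ 2 := by
          have h2 : Real.exp (1 / 2) * Real.exp (1 / 2) = Real.exp 1 := by
            rw [← Real.exp_add]; norm_num
          nlinarith [Real.exp_one_lt_d9, Real.exp_pos (1 / 2 : ℝ)]
  refine copsWin_of_matching (q := q) w (fun v => ?_) (fun v => ?_)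
  · have h1 := h.lower {v} (Finset.singleton_nonempty v) (by simp; linarith)
    have h2 : d / n ≤ 1 := (div_le_one hnpos).2 (hdq.trans hdn)
    have h3 : (0 : ℝ) < (outerBoundary G {v}).card := by
      refine lt_of_lt_of_le ?_ h1
      simp only [Finset.card_singleton, Nat.cast_one, mul_one]
      apply mul_pos (by linarith)
      linarith
    obtain ⟨x, hx⟩ := Finset.card_pos.1 (by exact_mod_cast h3)
    obtain ⟨-, y, hy, hyx⟩ := mem_outerBoundary.1 hx
    rw [Finset.mem_singleton] at hy
    exact ⟨x, hy ▸ hyx⟩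
  · refine (Fintype.all_card_le_filter_rel_iff_exists_injective
      (fun (e : edgesMeeting G (ball G q {v})) (i : Fin K) =>
        ∃ y ∈ e.1, w i ∈ ball G q {y})).1 fun A => ?_
    rcases A.eq_empty_or_nonempty with rfl | ⟨e₁, he₁⟩
    · simp
    let Y : Finset V := Finset.univ.filter fun x => ∃ e ∈ A, x ∈ e.1
    have hYne : Y.Nonempty :=
      ⟨e₁.2.2.choose, Finset.mem_filter.2
        ⟨Finset.mem_univ _, e₁, he₁, e₁.2.2.choose_spec.1⟩⟩
    have hYball : Y ⊆ ball G (q + 1) {v} := by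
      intro x hx
      obtain ⟨-, ⟨e, heE, z, hze, hz⟩, heA, hxe⟩ := Finset.mem_filter.1 hx
      rw [mem_ball_succ]
      by_cases hxz : z = x
      · exact Or.inl (hxz ▸ hz)
      · obtain rfl : e = s(z, x) := (Sym2.mem_and_mem_iff hxz).1 ⟨hze, hxe⟩
        exact Or.inr ⟨z, hz, heE⟩
    have hYcard : (Y.card : ℝ) ≤ 2 * d ^ (q + 1) := by
      calc (Y.card : ℝ) ≤ (ball G (q + 1) {v}).card := by exact_mod_cast Finset.card_le_card hYball
        _ ≤ ((1 + 2 * ε) * d) ^ (q + 1) * ({v} : Finset V).card :=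
          h.card_ball_le hεd hε _ (Finset.singleton_nonempty v)
        _ = (1 + 2 * ε) ^ (q + 1) * d ^ (q + 1) := by simp [mul_pow]
        _ ≤ _ := by gcongr
    have hAY : (A.card : ℝ) ≤ 7 * L * Y.card := by
      refine le_trans ?_ (h.sparse Y hYne hYcard)
      rw [← Finset.card_image_of_injective A Subtype.val_injective]
      norm_cast
      refine Finset.card_le_card fun e he => ?_
      obtain ⟨e, heA, rfl⟩ := Finset.mem_image.1 he
      refine Finset.mem_filter.2 ⟨Finset.mem_sym2_iff.2 fun x hx => ?_, e.2.1⟩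
      exact Finset.mem_filter.2 ⟨Finset.mem_univ _, e, heA, hx⟩
    have hAE : (A.card : ℝ) ≤ 2 * d ^ (q + 1) := by
      calc (A.card : ℝ) ≤ (edgesMeeting G (ball G q {v})).ncard := by
            rw [← Finset.card_image_of_injective A Subtype.val_injective, ← Set.ncard_coe_finset]
            refine Nat.cast_le.2 (Set.ncard_le_ncard ?_ (edgesMeeting G (ball G q {v})).toFinite)
            intro e he
            simp only [Finset.coe_image, Set.mem_image] at he
            obtain ⟨e, -, rfl⟩ := he
            exact e.2
        _ ≤ (1 + ε) * d * (ball G q {v}).card := h.ncard_edgesMeeting_le _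
        _ ≤ ((1 + 2 * ε) * d) * (((1 + 2 * ε) * d) ^ q * ({v} : Finset V).card) := by
            gcongr
            · linarith
            · exact h.card_ball_le hεd hε _ (Finset.singleton_nonempty v)
        _ = (1 + 2 * ε) ^ (q + 1) * d ^ (q + 1) := by
            rw [Finset.card_singleton, mul_pow]; push_cast; ring
        _ ≤ _ := by gcongr
    have hreach : ∀ Z ⊆ Y, (Finset.univ.filter fun i => w i ∈ ball G q Z) ⊆
        Finset.univ.filter fun i => ∃ e ∈ A, ∃ y ∈ e.1, w i ∈ ball G q {y} := by
      intro Z hZ i hi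
      obtain ⟨y, hy, hiy⟩ := exists_mem_ball_singleton (Finset.mem_filter.1 hi).2
      obtain ⟨-, e, he, hye⟩ := Finset.mem_filter.1 (hZ hy)
      exact Finset.mem_filter.2 ⟨Finset.mem_univ _, e, he, y, hye, hiy⟩
    suffices hs : ∃ Z ⊆ Y, Z.Nonempty ∧ (Z.card : ℝ) ≤ n / d ^ q ∧
        (A.card : ℝ) ≤ 7 * L * Z.card by
      obtain ⟨Z, hZY, hZne, hZm, hZA⟩ := hs
      have h1 := hZA.trans (hw Z hZne hZm)
      refine le_trans (by exact_mod_cast h1) (Finset.card_le_card (hreach Z hZY))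
    by_cases hYm : (Y.card : ℝ) ≤ n / d ^ q
    · exact ⟨Y, subset_rfl, hYne, hYm, hAY⟩
    · have hm1 : 1 ≤ n / d ^ q := (one_le_div hdpow).2 hdn
      have hfl : ⌊n / d ^ q⌋₊ ≤ Y.card := by
        have := Nat.floor_le (by linarith : 0 ≤ n / d ^ q)
        exact_mod_cast this.trans (not_le.1 hYm).le
      obtain ⟨Z, hZY, hZc⟩ := Finset.exists_subset_card_eq hfl
      have hflpos : 1 ≤ ⌊n / d ^ q⌋₊ := Nat.le_floor (by exact_mod_cast hm1)
      refine ⟨Z, hZY, Finset.card_pos.1 (by omega), ?_, hAE.trans ?_⟩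
      · rw [hZc]; exact Nat.floor_le (by linarith)
      · rw [hZc]
        have h1 := Nat.lt_floor_add_one (n / d ^ q)
        have h2 : (1 : ℝ) ≤ ⌊n / d ^ q⌋₊ := by exact_mod_cast hflpos
        have h3 : d ^ (q + 1) ≤ L * (n / d ^ q) := by
          rw [← mul_div_assoc, le_div_iff₀ hdpow]
          calc d ^ (q + 1) * d ^ q = d ^ (2 * q + 1) := by ring
            _ ≤ _ := by linarith
        nlinarith

end pseudorandom

/-! ### Concentration -/

section concentration

variable {V : Type*} [Fintype V]

/-- The vertices `x` outside `S` lie in the outer boundary independently of each other, as the sets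
of pairs `s(y, x)` with `y ∈ S` are disjoint for distinct `x`. -/
theorem measure_outerBoundary_tail (p : unitInterval) (S : Finset V) (l t : ℝ) :
    (SimpleGraph.binomialRandom V p).real
        {G | l * t ≤ l * ((outerBoundary G S).card : ℝ)} ≤
      Real.exp (-(l * t) + (Real.exp l - 1) *
        ((Fintype.card V - S.card) * (1 - (1 - (p : ℝ)) ^ S.card))) := by
  classical
  have h := measure_hitting_tail p Sᶜ (fun x => S.image fun y => s(y, x)) (by
      intro x hx e he
      obtain ⟨y, hy, rfl⟩ := Finset.mem_image.1 he
      rw [Finset.mem_compl] at hx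
      simp only [Sym2.mk_isDiag_iff]
      rintro rfl
      exact hx hy) (by
      intro x hx x' hx' hne
      simp only [Finset.coe_compl, Set.mem_compl_iff, Finset.mem_coe] at hx hx'
      rw [Function.onFun, Finset.disjoint_left]
      intro e he he'
      obtain ⟨y, hy, rfl⟩ := Finset.mem_image.1 he
      obtain ⟨y', hy', h⟩ := Finset.mem_image.1 he'
      rcases Sym2.eq_iff.1 h with ⟨-, h⟩ | ⟨h, -⟩
      · exact hne h.symm
      · exact hx (h ▸ hy')) l t
  have hset : ∀ G : SimpleGraph V, (Sᶜ.filter fun x =>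
      ∃ e ∈ S.image (fun y => s(y, x)), e ∈ G.edgeSet) = outerBoundary G S := by
    intro G
    ext x
    simp [mem_outerBoundary]
  have hcard : ∀ x ∈ Sᶜ, (1 - (1 - (p : ℝ)) ^ (S.image fun y => s(y, x)).card) =
      1 - (1 - (p : ℝ)) ^ S.card := by
    intro x _
    rw [Finset.card_image_of_injective]
    intro y y' hyy
    rcases Sym2.eq_iff.1 hyy with ⟨h, -⟩ | ⟨h, h'⟩
    · exact h
    · exact h.trans h'
  simp_rw [hset] at h
  rw [Finset.sum_congr rfl hcard, Finset.sum_const, nsmul_eq_mul, Finset.card_compl,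
    Nat.cast_sub (Finset.card_le_univ S)] at h
  exact h

open Classical in
/-- The upper tail of the number of edges spanned by `S`. -/
theorem measure_edges_tail (p : unitInterval) (S : Finset V) (t : ℝ) :
    (SimpleGraph.binomialRandom V p).real
        {G | t ≤ ((S.sym2.filter (· ∈ G.edgeSet)).card : ℝ)} ≤
      Real.exp (-t + 9 / 5 * (p * S.card ^ 2)) := by
  have h := measure_hitting_tail p (S.sym2.filter fun e => ¬ e.IsDiag) (fun e => {e}) (by
      intro e he e' he'
      rw [Finset.mem_singleton.1 he']
      exact (Finset.mem_filter.1 he).2) (by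
      intro e _ e' _ hne
      simpa [Function.onFun] using hne) 1 t
  have hset : ∀ G : SimpleGraph V, ((S.sym2.filter fun e => ¬ e.IsDiag).filter fun e =>
      ∃ e' ∈ ({e} : Finset (Sym2 V)), e' ∈ G.edgeSet) = S.sym2.filter (· ∈ G.edgeSet) := by
    intro G
    ext e
    simp only [Finset.mem_singleton, exists_eq_left, Finset.mem_filter]
    exact ⟨fun h => ⟨h.1.1, h.2⟩, fun h => ⟨⟨h.1, G.not_isDiag_of_mem_edgeSet h.2⟩, h.2⟩⟩
  simp_rw [hset] at h
  simp only [one_mul, Finset.card_singleton, pow_one, sub_sub_cancel, Finset.sum_const,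
    nsmul_eq_mul] at h
  refine h.trans (Real.exp_le_exp.2 ?_)
  have hcard : (((S.sym2.filter fun e => ¬ e.IsDiag).card : ℕ) : ℝ) ≤ (S.card : ℝ) ^ 2 := by
    have h1 := Finset.card_filter_le S.sym2 fun e => ¬ e.IsDiag
    rw [Finset.card_sym2, Nat.choose_two_right] at h1
    have h2 : (S.card + 1) * (S.card + 1 - 1) / 2 ≤ S.card ^ 2 := by
      rw [Nat.add_sub_cancel]
      apply Nat.div_le_of_le_mul
      nlinarith [Nat.le_self_pow two_ne_zero S.card]
    exact_mod_cast h1.trans h2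
  have hp := p.2.1
  have h1 : Real.exp 1 - 1 ≤ 9 / 5 := by linarith [Real.exp_one_lt_d9]
  have h2 : 0 ≤ Real.exp 1 - 1 := by linarith [Real.add_one_le_exp 1]
  rw [mul_comm (p : ℝ)]
  gcongr

/-- The second Bonferroni inequality for `s` independent events of probability `x`. -/
theorem one_sub_pow_le {x : ℝ} (hx : 0 ≤ x) (hx1 : x ≤ 1) (s : ℕ) :
    (1 - x) ^ s ≤ 1 - s * x + (s * x) ^ 2 / 2 := by
  induction s with
  | zero => simp
  | succ s ih =>
    have h1 := mul_le_mul_of_nonneg_right ih (by linarith : 0 ≤ 1 - x)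
    rw [pow_succ]
    push_cast
    have h2 : 0 ≤ (s : ℝ) ^ 2 * x ^ 3 := by positivity
    nlinarith

/-- A lower bound on the expected size of the outer boundary of a set of `s` vertices in a random
graph on `n` vertices with edge probability `x` and average degree `d`. -/
theorem le_mean_outerBoundary {n d a : ℝ} {x : ℝ} (s : ℕ) (hs : 1 ≤ s) (hx : 0 ≤ x) (hx1 : x ≤ 1)
    (hn : 4 ≤ n) (hd : d = x * (n - 1)) (hd1 : 1 ≤ d) (ha : a = d * s / n) (ha1 : a ≤ 1) :
    d * s * (1 - 1 / d - 2 / 3 * a) ≤ (n - s) * (1 - (1 - x) ^ s) := by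
  have hs1 : (1 : ℝ) ≤ s := by exact_mod_cast hs
  have h1 : s * x * (1 - s * x / 2) ≤ 1 - (1 - x) ^ s := by
    have := one_sub_pow_le hx hx1 s
    linarith
  have han : d * s = a * n := by rw [ha]; field_simp
  have hsn : (s : ℝ) ≤ n := by nlinarith
  have hxs : s * x / 2 ≤ 2 / 3 * a := by
    have h2 : s * x * (n - 1) = a * n := by rw [← han, hd]; ring
    have ha0 : 0 ≤ a := by rw [ha]; positivity
    have h3 : s * x * (n - 1) ≤ (4 / 3 * a) * (n - 1) := by rw [h2]; nlinarith
    have := le_of_mul_le_mul_right h3 (by linarith)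
    linarith
  have hns : d * s * (1 - 1 / d) ≤ (n - s) * (s * x) := by
    have h4 : d * s * (1 - 1 / d) = (d - 1) * s := by field_simp
    rw [h4]
    have h5 : d - 1 ≤ (n - s) * x := by
      have h6 : s * x ≤ 1 + x := by
        have h2 : s * x * (n - 1) = a * n := by rw [← han, hd]; ring
        have h7 : s * x * (n - 1) ≤ (1 + x) * (n - 1) := by
          rw [h2]; nlinarith
        exact le_of_mul_le_mul_right h7 (by linarith)
      nlinarith
    nlinarith
  have ha0 : 0 ≤ a := by rw [ha]; positivity
  have hinv : 0 ≤ 1 - 1 / d := by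
    rw [sub_nonneg, div_le_one (by linarith)]; exact hd1
  have hinv' : 0 ≤ 1 / d := by positivity
  calc d * s * (1 - 1 / d - 2 / 3 * a)
      ≤ d * s * (1 - 1 / d) * (1 - 2 / 3 * a) := by
        have : d * s * (1 - 1 / d) * (1 - 2 / 3 * a) =
          d * s * (1 - 1 / d - 2 / 3 * a) + d * s * (1 / d * (2 / 3 * a)) := by ring
        rw [this]
        have : 0 ≤ d * s * (1 / d * (2 / 3 * a)) := by positivity
        linarith
    _ ≤ (n - s) * (s * x) * (1 - s * x / 2) := by
        gcongr
        linarith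
    _ = (n - s) * (s * x * (1 - s * x / 2)) := by ring
    _ ≤ _ := by gcongr

variable {p : unitInterval} {d ε L M : ℝ}

open Classical in
theorem measure_not_sparse_le (hpM : p * M ≤ 20 / 9 * L) (S : Finset V)
    (hSM : (S.card : ℝ) ≤ M) :
    (SimpleGraph.binomialRandom V p).real
      {G | 7 * L * S.card ≤ ((S.sym2.filter (· ∈ G.edgeSet)).card : ℝ)} ≤
        Real.exp (-3 * L) ^ S.card := by
  refine (measure_edges_tail p S _).trans ?_
  rw [← Real.exp_nat_mul, Real.exp_le_exp]
  have hp := p.2.1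
  have h1 : p * (S.card : ℝ) ^ 2 ≤ 20 / 9 * L * S.card := by
    calc p * (S.card : ℝ) ^ 2 = p * S.card * S.card := by ring
      _ ≤ p * M * S.card := by gcongr
      _ ≤ _ := by gcongr
  linarith

theorem measure_not_upper_le (hε : 0 < ε) (hε1 : ε ≤ 1) (hd : d = p * (Fintype.card V - 1))
    (hd0 : 0 < d) (hLd : 12 * L ≤ ε ^ 2 * d) {S : Finset V} (hS : S.Nonempty) :
    (SimpleGraph.binomialRandom V p).real
      {G | (1 + ε) * d * S.card ≤ ((outerBoundary G S).card : ℝ)} ≤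
        Real.exp (-3 * L) ^ S.card := by
  have h := measure_outerBoundary_tail p S (ε / 2) ((1 + ε) * d * S.card)
  simp only [mul_le_mul_iff_right₀ (half_pos hε)] at h
  refine h.trans ?_
  rw [← Real.exp_nat_mul, Real.exp_le_exp]
  have hs : (1 : ℝ) ≤ S.card := by exact_mod_cast hS.card_pos
  have hsn : (S.card : ℝ) ≤ Fintype.card V := by exact_mod_cast Finset.card_le_univ S
  have hp := p.2.1
  have hmean : (Fintype.card V - S.card) * (1 - (1 - (p : ℝ)) ^ S.card) ≤ d * S.card := by
    have h1 := one_add_mul_le_pow (a := -(p : ℝ)) (by linarith [p.2.2]) S.card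
    rw [← sub_eq_add_neg] at h1
    calc (Fintype.card V - S.card) * (1 - (1 - (p : ℝ)) ^ S.card)
        ≤ (Fintype.card V - 1) * (S.card * p) := by
          gcongr
          · linarith [pow_le_one₀ (n := S.card) (by linarith [p.2.2] : 0 ≤ 1 - (p : ℝ))
              (by linarith)]
          · linarith
          · linarith
      _ = _ := by rw [hd]; ring
  have hexp := (abs_le.1 (Real.abs_exp_sub_one_sub_id_le
    (by rw [abs_of_pos (half_pos hε)]; linarith : |ε / 2| ≤ 1))).2
  have hexp0 : 0 ≤ Real.exp (ε / 2) - 1 := by linarith [Real.add_one_le_exp (ε / 2)]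
  have h2 : (Real.exp (ε / 2) - 1) *
      ((Fintype.card V - S.card) * (1 - (1 - (p : ℝ)) ^ S.card)) ≤
      (ε / 2 + (ε / 2) ^ 2) * (d * S.card) := by
    refine mul_le_mul (by linarith) hmean (mul_nonneg (by linarith) ?_) (by positivity)
    linarith [pow_le_one₀ (n := S.card) (by linarith [p.2.2] : 0 ≤ 1 - (p : ℝ)) (by linarith)]
  have h3 : 12 * L * S.card ≤ ε ^ 2 * d * S.card := by gcongr
  nlinarith

theorem measure_not_lower_le (hε : 0 < ε) (hε1 : ε ≤ 1) (hd : d = p * (Fintype.card V - 1))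
    (hn : 4 ≤ Fintype.card V) (hεd : 2 ≤ ε * d) (hL : 0 ≤ L) (hLd : 12 * L ≤ ε ^ 2 * d) {S : Finset V}
    (hS : S.Nonempty) (hSn : d * S.card ≤ Fintype.card V) :
    (SimpleGraph.binomialRandom V p).real
      {G | ((outerBoundary G S).card : ℝ) ≤
        d * S.card * (1 - 2 * ε - 2 / 3 * (d * S.card / Fintype.card V))} ≤
        Real.exp (-3 * L) ^ S.card := by
  set a := d * S.card / Fintype.card V with ha
  have h := measure_outerBoundary_tail p S (-ε) (d * S.card * (1 - 2 * ε - 2 / 3 * a))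
  simp only [neg_mul, neg_le_neg_iff, mul_le_mul_iff_right₀ hε] at h
  refine h.trans ?_
  rw [← Real.exp_nat_mul, Real.exp_le_exp]
  have hs : (1 : ℝ) ≤ S.card := by exact_mod_cast hS.card_pos
  have hn' : (4 : ℝ) ≤ Fintype.card V := by exact_mod_cast hn
  have hd1 : 2 ≤ d := by nlinarith
  have ha1 : a ≤ 1 := (div_le_one (by linarith)).2 hSn
  have ha0 : 0 ≤ a := by positivity
  have hmean := le_mean_outerBoundary S.card hS.card_pos p.2.1 p.2.2 hn' hd (by linarith) ha ha1
  have hexp := (abs_le.1 (Real.abs_exp_sub_one_sub_id_le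
    (by rw [abs_neg, abs_of_pos hε]; exact hε1 : |-ε| ≤ 1))).2
  have hinv : 1 / d ≤ ε / 2 := by
    rw [div_le_iff₀ (by linarith)]; linarith
  have hinv0 : 0 ≤ 1 / d := by positivity
  have h1 : (ε - ε ^ 2) * (d * S.card * (1 - 1 / d - 2 / 3 * a)) ≤
      (1 - Real.exp (-ε)) *
        ((Fintype.card V - S.card) * (1 - (1 - (p : ℝ)) ^ S.card)) := by
    calc _ ≤ (ε - ε ^ 2) *
          ((Fintype.card V - S.card) * (1 - (1 - (p : ℝ)) ^ S.card)) := by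
          gcongr
          nlinarith
      _ ≤ _ := by
          refine mul_le_mul_of_nonneg_right (by linarith) (mul_nonneg ?_ ?_)
          · rw [sub_nonneg]; exact_mod_cast Finset.card_le_univ S
          · linarith [pow_le_one₀ (n := S.card) (by linarith [p.2.2] : 0 ≤ 1 - (p : ℝ))
              (by linarith [p.2.1])]
  have h2 : 12 * L * S.card ≤ ε ^ 2 * d * S.card := by gcongr
  have hds : 0 ≤ d * S.card := by positivity
  have h3 : d * S.card * (ε * (1 - 2 * ε - 2 / 3 * a) -
      (ε - ε ^ 2) * (1 - 1 / d - 2 / 3 * a)) ≤ d * S.card * (-(ε ^ 2 / 2)) := by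
    gcongr
    nlinarith [mul_le_mul_of_nonneg_left hinv hε.le, mul_nonneg (sq_nonneg ε) hinv0,
      mul_nonneg (sq_nonneg ε) ha0]
  have hLs : 0 ≤ L * S.card := by positivity
  linarith

theorem measure_not_isPseudorandom_le (hε : 0 < ε) (hε1 : ε ≤ 1)
    (hd : d = p * (Fintype.card V - 1)) (hn : 4 ≤ Fintype.card V) (hεd : 2 ≤ ε * d)
    (hL : 0 ≤ L) (hLd : 12 * L ≤ ε ^ 2 * d) (hpM : p * M ≤ 20 / 9 * L) :
    (SimpleGraph.binomialRandom V p).real {G | ¬ IsPseudorandom G d ε L M} ≤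
      3 * (Real.exp (Fintype.card V * Real.exp (-3 * L)) - 1) := by
  classical
  have hd0 : 0 < d := by by_contra h; nlinarith
  let P := (Finset.univ : Finset (Finset V)).filter (·.Nonempty)
  let A₁ : Finset V → Set (SimpleGraph V) := fun S => {G | (S.card : ℝ) ≤ M ∧
    7 * L * S.card ≤ ((S.sym2.filter (· ∈ G.edgeSet)).card : ℝ)}
  let A₂ : Finset V → Set (SimpleGraph V) := fun S =>
    {G | (1 + ε) * d * S.card ≤ ((outerBoundary G S).card : ℝ)}
  let A₃ : Finset V → Set (SimpleGraph V) := fun S => {G | d * S.card ≤ Fintype.card V ∧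
    ((outerBoundary G S).card : ℝ) ≤
        d * S.card * (1 - 2 * ε - 2 / 3 * (d * S.card / Fintype.card V))}
  have hsub : {G | ¬ IsPseudorandom G d ε L M} ⊆ ⋃ S ∈ P, (A₁ S ∪ A₂ S ∪ A₃ S) := by
    intro G hG
    by_contra hcon
    simp only [Set.mem_iUnion, not_exists, P, Finset.mem_filter, Finset.mem_univ, true_and] at hcon
    refine hG ⟨fun S hS hM => ?_, fun S hS => ?_, fun S hS hSn => ?_⟩ <;> by_contra! hlt <;>
      refine hcon S hS ?_
    · exact Or.inl (Or.inl ⟨hM, hlt.le⟩)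
    · exact Or.inl (Or.inr hlt.le)
    · exact Or.inr ⟨hSn, hlt.le⟩
  have hbad : ∀ S ∈ P, (SimpleGraph.binomialRandom V p).real (A₁ S ∪ A₂ S ∪ A₃ S) ≤
      3 * Real.exp (-3 * L) ^ S.card := by
    intro S hS
    have hSne := (Finset.mem_filter.1 hS).2
    have hpos : 0 ≤ Real.exp (-3 * L) ^ S.card := by positivity
    have h1 : (SimpleGraph.binomialRandom V p).real (A₁ S) ≤ Real.exp (-3 * L) ^ S.card := by
      by_cases hM : (S.card : ℝ) ≤ M
      · simpa [A₁, hM] using measure_not_sparse_le hpM S hM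
      · simpa [A₁, hM] using hpos
    have h2 := measure_not_upper_le hε hε1 hd hd0 hLd hSne
    have h3 : (SimpleGraph.binomialRandom V p).real (A₃ S) ≤ Real.exp (-3 * L) ^ S.card := by
      by_cases hSn : d * S.card ≤ Fintype.card V
      · simpa [A₃, hSn] using measure_not_lower_le hε hε1 hd hn hεd hL hLd hSne hSn
      · simpa [A₃, hSn] using hpos
    have h4 := measureReal_union_le (μ := SimpleGraph.binomialRandom V p) (A₁ S ∪ A₂ S) (A₃ S)
    have h5 := measureReal_union_le (μ := SimpleGraph.binomialRandom V p) (A₁ S) (A₂ S)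
    linarith
  calc (SimpleGraph.binomialRandom V p).real {G | ¬ IsPseudorandom G d ε L M}
      ≤ (SimpleGraph.binomialRandom V p).real (⋃ S ∈ P, (A₁ S ∪ A₂ S ∪ A₃ S)) :=
        measureReal_mono hsub (measure_ne_top _ _)
    _ ≤ ∑ S ∈ P, (SimpleGraph.binomialRandom V p).real (A₁ S ∪ A₂ S ∪ A₃ S) :=
        measureReal_biUnion_finset_le _ _
    _ ≤ ∑ S ∈ P, 3 * Real.exp (-3 * L) ^ S.card := Finset.sum_le_sum hbad
    _ = 3 * ∑ S ∈ P, Real.exp (-3 * L) ^ S.card := by rw [Finset.mul_sum]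
    _ ≤ _ := by
        gcongr
        exact sum_pow_card_nonempty_le _ (Real.exp_pos _).le

end concentration

/-- The upper bound on the containability number for a fixed number of vertices, with the radius
`q = r - 1` of the balls in which the robber is caught. The error `ε` is chosen of order `1 / q`, so
that `q` growth steps lose a constant factor altogether; `d ≥ log n ^ 3` makes boundaries
concentrated to that precision. -/
theorem measure_containability_gt_le {n q : ℕ} {p : unitInterval} {d : ℝ}
    (hd : d = p * ((n : ℝ) - 1)) (hn : 101 ≤ n) (hq : 1 ≤ q)
    (hlog : Real.log n ^ 3 ≤ d) (hqL : 60 * ((q : ℝ) + 1) ≤ Real.log n)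
    (hdL : d ^ (2 * q + 1) ≤ n * Real.log n) :
    (SimpleGraph.binomialRandom (Fin n) p).real
      {G | ¬ (containability G : ℝ) ≤ 161 * (n * Real.log n / d ^ q)} ≤
      3 * (Real.exp (1 / (n : ℝ) ^ 2) - 1) := by
  set L := Real.log n with hLdef
  have hn' : (101 : ℝ) ≤ n := by exact_mod_cast hn
  have hq' : (1 : ℝ) ≤ q := by exact_mod_cast hq
  have hL : 120 ≤ L := by nlinarith
  have hL2 : 1 ≤ L ^ 2 := by nlinarith
  have hLd : L ≤ d := by nlinarith
  have hexp : Real.exp (-3 * L) = 1 / (n : ℝ) ^ 3 := by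
    rw [hLdef, neg_mul, Real.exp_neg, one_div, mul_comm, Real.exp_mul, Real.exp_log (by linarith)]
    norm_cast
  have hnexp : (n : ℝ) * Real.exp (-3 * L) = 1 / (n : ℝ) ^ 2 := by
    rw [hexp]; field_simp
  have hd1 : 1 ≤ d := by linarith
  let ε : ℝ := 1 / (16 * ((q : ℝ) + 1))
  have hε : 0 < ε := by positivity
  have hεq : ε * (16 * ((q : ℝ) + 1)) = 1 := by simp only [ε]; field_simp
  have hε1 : ε ≤ 1 := by nlinarith
  have hLε : 15 / 4 ≤ ε * L := by nlinarith
  have hεd : 2 ≤ ε * d := by nlinarith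
  have hLd2 : 12 * L ≤ ε ^ 2 * d := by
    have h1 : ε ^ 2 * L ^ 3 ≤ ε ^ 2 * d := by gcongr
    have h2 : (15 / 4) ^ 2 ≤ (ε * L) ^ 2 := by gcongr
    nlinarith
  have hpow : d ^ (q + 2) ≤ n * L :=
    (pow_le_pow_right₀ hd1 (by omega : q + 2 ≤ 2 * q + 1)).trans hdL
  have hpM : p * (2 * d ^ (q + 1)) ≤ 20 / 9 * L := by
    have h1 : p * (2 * d ^ (q + 1)) * (n - 1) ≤ 20 / 9 * L * (n - 1) := by
      calc p * (2 * d ^ (q + 1)) * (n - 1) = 2 * d ^ (q + 2) := by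
            rw [pow_succ d (q + 1)]; nth_rewrite 3 [hd]; ring
        _ ≤ 2 * (n * L) := by gcongr
        _ ≤ _ := by nlinarith
    exact le_of_mul_le_mul_right h1 (by linarith)
  have hdpow : 0 < d ^ q := by positivity
  have hdn : d ^ q ≤ n := by
    have h1 : d ^ (2 * q) * d ≤ n * d := by
      rw [← pow_succ]; exact hdL.trans (by gcongr)
    exact (pow_le_pow_right₀ hd1 (by omega : q ≤ 2 * q)).trans
      (le_of_mul_le_mul_right h1 (by linarith))
  have hmain := measure_not_isPseudorandom_le (V := Fin n) (p := p) (M := 2 * d ^ (q + 1)) hε hε1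
    (by simpa using hd) (by simpa using by omega) hεd (by linarith) hLd2 hpM
  rw [Fintype.card_fin, hnexp] at hmain
  refine (measureReal_mono ?_ (measure_ne_top _ _)).trans hmain
  intro G hG hps
  refine hG ?_
  have : Nonempty (Fin n) := ⟨⟨0, by omega⟩⟩
  let K := ⌈160 * (n * L / d ^ q)⌉₊
  have hone : 1 ≤ n * L / d ^ q := by
    rw [one_le_div hdpow]
    nlinarith
  have hwin : CopsWin G K := by
    refine hps.copsWin (by linarith) hε hq hεq.le (by linarith) (by simpa using hdn)
      (by simpa using hdL) ?_ ?_
    · rw [Fintype.card_fin, hnexp, div_le_div_iff₀ (by positivity) (by norm_num)]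
      nlinarith
    · rw [Fintype.card_fin, ← div_le_iff₀ hdpow, mul_div_assoc]
      exact Nat.le_ceil _
  have hK : (K : ℝ) ≤ 161 * (n * L / d ^ q) := by
    have := (Nat.ceil_lt_add_one (by linarith : 0 ≤ 160 * (n * L / d ^ q))).le
    linarith
  exact le_trans (by exact_mod_cast Nat.sInf_le hwin) hK

end Containment

theorem lemma2p6 (p : ℕ → unitInterval) (d : ℕ → ℝ) (r : ℕ → ℕ)
    (hd : ∀ n, d n = (p n : ℝ) * ((n : ℝ) - 1))
    (hlog : ∀ᶠ n : ℕ in atTop, Real.log n ^ 3 ≤ d n)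
    (hr : ∀ᶠ n : ℕ in atTop, 2 ≤ r n)
    (hlower : ∀ᶠ n : ℕ in atTop,
      ((n : ℝ) * Real.log n) ^ (1 / (2 * (r n : ℝ))) ≤ d n)
    (hupper : ∀ᶠ n : ℕ in atTop,
      d n ≤ ((n : ℝ) * Real.log n) ^ (1 / (2 * (r n : ℝ) - 1))) :
    ∃ C : ℝ, 0 < C ∧
      Tendsto (fun n : ℕ => SimpleGraph.binomialRandom (Fin n) (p n)
          {G | (Containment.containability G : ℝ) ≤
            C * ((n : ℝ) * Real.log n / d n ^ (r n - 1))})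
        atTop (𝓝 1) := by
  refine ⟨161, by norm_num, ?_⟩
  have hlogtop : Tendsto (fun n : ℕ => Real.log n) atTop atTop :=
    Real.tendsto_log_atTop.comp tendsto_natCast_atTop_atTop
  have hbound : ∀ᶠ n : ℕ in atTop,
      ENNReal.ofReal (1 - 3 * (Real.exp (1 / (n : ℝ) ^ 2) - 1)) ≤
        SimpleGraph.binomialRandom (Fin n) (p n)
          {G | (Containment.containability G : ℝ) ≤
            161 * ((n : ℝ) * Real.log n / d n ^ (r n - 1))} := by
    filter_upwards [hlog, hr, hupper, eventually_ge_atTop 101,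
      hlogtop.eventually_ge_atTop (Real.exp 120)] with n hlog hr hupper hn hbig
    obtain ⟨q, hq⟩ : ∃ q, r n = q + 1 := ⟨r n - 1, by omega⟩
    have hq1 : 1 ≤ q := by omega
    have hL : 121 ≤ Real.log n := by linarith [Real.add_one_le_exp (120 : ℝ)]
    have hn0 : (0 : ℝ) < n := by positivity
    have hd0 : 0 < d n := lt_of_lt_of_le (by positivity) hlog
    have hdL : d n ^ (2 * q + 1) ≤ n * Real.log n := by
      have hcast : 2 * (r n : ℝ) - 1 = ((2 * q + 1 : ℕ) : ℝ) := by
        rw [hq]; push_cast; ring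
      rw [hcast, one_div] at hupper
      calc d n ^ (2 * q + 1)
          ≤ (((n : ℝ) * Real.log n) ^ (((2 * q + 1 : ℕ) : ℝ)⁻¹)) ^ (2 * q + 1) := by gcongr
        _ = _ := Real.rpow_inv_natCast_pow (by positivity) (by omega)
    -- `d` exceeds the constant `exp 120`, so `d ^ (2 * q + 1) ≤ n ^ 2` bounds `q`
    have hqL : 60 * ((q : ℝ) + 1) ≤ Real.log n := by
      have h1 : Real.exp 120 ≤ d n := by nlinarith [sq_nonneg (Real.log n), Real.exp_pos 120]
      have h2 : Real.exp ((2 * q + 1 : ℕ) * 120) ≤ Real.exp (Real.log n + Real.log n) := by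
        calc Real.exp ((2 * q + 1 : ℕ) * 120) = Real.exp 120 ^ (2 * q + 1) := Real.exp_nat_mul _ _
          _ ≤ d n ^ (2 * q + 1) := by gcongr
          _ ≤ n * Real.log n := hdL
          _ ≤ n * n := by gcongr; exact (Real.log_le_sub_one_of_pos hn0).trans (by linarith)
          _ = _ := by rw [Real.exp_add, Real.exp_log hn0]
      rw [Real.exp_le_exp] at h2
      push_cast at h2
      linarith
    have h := Containment.measure_containability_gt_le (hd n) hn hq1 hlog hqL hdL
    have hq' : r n - 1 = q := by omega
    rw [hq']
    rw [← Set.compl_ofPred, MeasureTheory.probReal_compl_eq_one_sub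
      (Set.toFinite _).measurableSet] at h
    rw [← MeasureTheory.ofReal_measureReal]
    exact ENNReal.ofReal_le_ofReal (by linarith)
  refine tendsto_of_tendsto_of_tendsto_of_le_of_le' ?_ tendsto_const_nhds hbound
    (Eventually.of_forall fun n => MeasureTheory.prob_le_one)
  have h1 : Tendsto (fun n : ℕ => 1 / (n : ℝ) ^ 2) atTop (𝓝 0) := by
    have := ((tendsto_pow_atTop (α := ℝ) two_ne_zero).comp
      tendsto_natCast_atTop_atTop).inv_tendsto_atTop
    simp only [one_div]
    exact this
  have h2 := ((Real.continuous_exp.tendsto 0).comp h1).sub_const 1 |>.const_mul 3 |>.const_sub 1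
  simpa using ENNReal.tendsto_ofReal h2
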